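/- Let $\mathbf{Set}$ be the category of (small) sets. - $\mathbf{List} = (\mathbf{Set}\downarrow\mathbf{Set})$ is the category of signatures: objects are functions $s : I \to X$ ($I$ the arity, $X$ the sort set), morphisms are commuting squares. Its projection is $\mathit{sort} : \mathbf{List} \to \mathbf{Set}$, $(I,s,X) \mapsto X$. For a set $X$, $\mathbf{List}(X) = (\mathbf{Set}\downarrow X)$ is the slice category over $X$. - $\mathbf{Cls}$ is the category of type domains (classifications) $\mathcal{A} = \langle X, Y, \models_{\mathcal{A}}\rangle$, where $X$ is a set (of sorts), $Y$ a set (of data values) and $\models_{\mathcal{A}} \subseteq Y \times X$. A morphism $\mathcal{A}_2 \to \mathcal{A}_1$ is a pair of functions $f : X_2 \to X_1$, $g : Y_1 \to Y_2$ such that $g(y_1) \models_{\mathcal{A}_2} x_2$ if and only if $y_1 \models_{\mathcal{A}_1} f(x_2)$, for all $x_2 \in X_2$, $y_1 \in Y_1$. Let $\mathit{sort} : \mathbf{Cls} \to \mathbf{Set}$, $\mathcal{A} \mapsto X$. - $\mathbf{Dom} = (\mathbf{Set} \downarrow \mathit{sort})$ is the category of signed domains $\langle I, s, \mathcal{A}\rangle$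 with $s : I \to X$; its morphisms are triples $\langle h, f, g\rangle$ with $\langle f, g\rangle$ a morphism of type domains and $s_1 h = f s_2$. The functor $\mathit{tup} : \mathbf{Dom}^{\mathrm{op}} \to \mathbf{Set}$ sends $\langle I, s, \mathcal{A}\rangle$ to $\{\, t : I \to Y \mid t(i) \models_{\mathcal{A}} s(i) \text{ for all } i \in I \,\}$ and a morphism $\langle h, f, g\rangle : \langle I_2, s_2, \mathcal{A}_2\rangle \to \langle I_1, s_1, \mathcal{A}_1\rangle$ to the function $t \mapsto g \circ t \circ h$. - $\mathbf{Tbl} = (\mathbf{Set} \downarrow \mathit{tup})$ is the category of tables: a key set $K$, a signed domain $\mathcal{D}$ and a function $K \to \mathit{tup}(\mathcal{D})$. Its projections are $\mathit{dom} : \mathbf{Tbl} \to \mathbf{Dom}^{\mathrm{op}}$ and the composite $\mathit{data} : \mathbf{Tbl} \to \mathbf{Dom}^{\mathrm{op}} \to \mathbf{Cls}^{\mathrm{op}}$. - For a type domain $\mathcal{A}$ with sort set $X$, $\mathit{tup}_{\mathcal{A}} : \mathbf{List}(X)^{\mathrm{op}} \to \mathbf{Set}$ is $\mathit{tup}$ restricted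 along $\langle I, s\rangle \mapsto \langle I, s, \mathcal{A}\rangle$, $h \mapsto \langle h, 1, 1\rangle$. The category of $\mathcal{A}$-tables is $\mathbf{Tbl}(\mathcal{A}) = (\mathbf{Set} \downarrow \mathit{tup}_{\mathcal{A}})$, with projection $\mathit{sign}_{\mathcal{A}} : \mathbf{Tbl}(\mathcal{A}) \to \mathbf{List}(X)^{\mathrm{op}}$. Then the categories $\mathbf{List}$, $\mathbf{Tbl}$ and, for every type domain $\mathcal{A}$, $\mathbf{Tbl}(\mathcal{A})$ have all small limits and all small colimits, and each of the projections $$\mathit{sort} : \mathbf{List} \to \mathbf{Set}, \quad \mathit{dom} : \mathbf{Tbl} \to \mathbf{Dom}^{\mathrm{op}}, \quad \mathit{sign}_{\mathcal{A}} : \mathbf{Tbl}(\mathcal{A}) \to \mathbf{List}(X)^{\mathrm{op}}, \quad \mathit{data} : \mathbf{Tbl} \to \mathbf{Cls}^{\mathrm{op}}$$ preserves all small limits and all small colimits. -/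

import Mathlib

open CategoryTheory CategoryTheory.Limits Opposite

universe u

namespace FOLE

/-- The context of signatures: the comma context `Set ↓ Set`. An object is a sort set `X`, an
arity set `I` and a function `I ⟶ X`. -/
abbrev Sign : Type (u + 1) := Comma (𝟭 (Type u)) (𝟭 (Type u))

/-- The sort projection `List ⥤ Set`. -/
abbrev Sign.sort : Sign.{u} ⥤ Type u := Comma.snd (𝟭 (Type u)) (𝟭 (Type u))

/-- A type domain (classification): a set of sorts, a set of data values, and a classification
relation between data values and sorts. -/
structure Cls : Type (u + 1) where
  Sorts : Type u
  Values : Type u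
  models : Values → Sorts → Prop

namespace Cls

/-- An infomorphism `A ⇄ B`: a forward sort function and a backward data value function
satisfying the infomorphism condition. -/
@[ext]
structure Hom (A B : Cls.{u}) : Type u where
  sortMap : A.Sorts ⟶ B.Sorts
  valueMap : B.Values ⟶ A.Values
  models_iff : ∀ (x : A.Sorts) (y : B.Values),
    A.models (valueMap y) x ↔ B.models y (sortMap x)

instance : Category.{u} Cls.{u} where
  Hom := Hom
  id A := { sortMap := 𝟙 _, valueMap := 𝟙 _, models_iff := fun _ _ => Iff.rfl }
  comp p q :=
    { sortMap := p.sortMap ≫ q.sortMap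
      valueMap := q.valueMap ≫ p.valueMap
      models_iff := fun x y =>
        (p.models_iff x (q.valueMap y)).trans (q.models_iff (p.sortMap x) y) }

/-- The sort projection `Cls ⥤ Set`. -/
def sort : Cls.{u} ⥤ Type u where
  obj A := A.Sorts
  map p := Hom.sortMap p

end Cls

/-- The context of signed domains: the comma context `Set ↓ sort`. An object is a type domain
with sort set `X`, an arity set `I` and a function `I ⟶ X`. -/
abbrev Dom : Type (u + 1) := Comma (𝟭 (Type u)) Cls.sort.{u}

/-- The type domain projection `Dom ⥤ Cls`. -/
abbrev Dom.data : Dom.{u} ⥤ Cls.{u} := Comma.snd (𝟭 (Type u)) Cls.sort.{u}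

/-- The function `s : I → X` of a signed domain. -/
def Dom.sorting (D : Dom.{u}) : D.left → D.right.Sorts := fun i => D.hom i

/-- The set of tuples of a signed domain: the functions `t : I → Y` such that the value `t i` is
of sort `s i` for every index `i`. -/
def Dom.Tuple (D : Dom.{u}) : Type u :=
  { t : D.left → D.right.Values // ∀ i, D.right.models (t i) (D.sorting i) }

/-- The tuple function of a signed domain morphism `⟨h, f, g⟩ : D₂ ⟶ D₁`,
sending a `D₁`-tuple `t` to the `D₂`-tuple `i ↦ g (t (h i))`. -/
def Dom.tupleMap {D₂ D₁ : Dom.{u}} (φ : D₂ ⟶ D₁) (t : D₁.Tuple) : D₂.Tuple :=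
  ⟨fun i => φ.right.valueMap (t.1 (φ.left i)), fun i => by
    have hw : φ.right.sortMap (D₂.sorting i) = D₁.sorting (φ.left i) :=
      (ConcreteCategory.congr_hom φ.w i).symm
    rw [φ.right.models_iff, hw]
    exact t.2 (φ.left i)⟩

/-- The tuple passage `Domᵒᵖ ⥤ Set`. -/
def tup : Dom.{u}ᵒᵖ ⥤ Type u where
  obj D := D.unop.Tuple
  map φ := TypeCat.ofHom (Dom.tupleMap φ.unop)
  map_id _ := rfl
  map_comp _ _ := rfl

/-- The context of tables: the comma context `Set ↓ tup`. An object is a signed domain `D`, a key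
set `K` and a function from `K` to the set of tuples of `D`. -/
abbrev Tbl : Type (u + 1) := Comma (𝟭 (Type u)) tup.{u}

/-- The signed domain projection `Tbl ⥤ Domᵒᵖ`. -/
abbrev Tbl.dom : Tbl.{u} ⥤ Dom.{u}ᵒᵖ := Comma.snd (𝟭 (Type u)) tup.{u}

/-- The type domain projection `Tbl ⥤ Clsᵒᵖ`. -/
abbrev Tbl.data : Tbl.{u} ⥤ Cls.{u}ᵒᵖ := Tbl.dom ⋙ Dom.data.op

/-- The context `Set ↓ X` of signatures over a fixed sort set `X`. -/
abbrev SignOver (X : Type u) : Type (u + 1) := Over X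

/-- The inclusion `List(X) ⥤ Dom` at a type domain `A` with sort set `X`, which sends `⟨I, s⟩` to
`⟨I, s, A⟩` and `h` to `⟨h, 1, 1⟩`. -/
def inc (A : Cls.{u}) : SignOver A.Sorts ⥤ Dom.{u} where
  obj S := { left := S.left, right := A, hom := S.hom }
  map {S' S} h :=
    { left := h.left
      right := 𝟙 A
      w := by
        have h1 : Cls.sort.map (𝟙 A) = 𝟙 A.Sorts := rfl
        have h2 : h.left ≫ S.hom = S'.hom := Over.w h
        rw [h1]
        exact h2.trans (Category.comp_id _).symm }

/-- The tuple passage `List(X)ᵒᵖ ⥤ Set` of a type domain `A` with sort set `X`. -/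
abbrev tupOver (A : Cls.{u}) : (SignOver A.Sorts)ᵒᵖ ⥤ Type u := (inc A).op ⋙ tup

/-- The context of `A`-tables: the comma context `Set ↓ tup_A`. -/
abbrev TblOver (A : Cls.{u}) : Type (u + 1) := Comma (𝟭 (Type u)) (tupOver A)

/-- The signature projection `Tbl(A) ⥤ List(X)ᵒᵖ`. -/
abbrev TblOver.sign (A : Cls.{u}) : TblOver A ⥤ (SignOver A.Sorts)ᵒᵖ :=
  Comma.snd (𝟭 (Type u)) (tupOver A)

/-- A projection `P : E ⥤ B` for which the context `E` has all small limits and colimits and `P`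
preserves all small limits and colimits. -/
structure IsBicompleteProjection {E B : Type (u + 1)} [Category.{u} E] [Category.{u} B]
    (P : E ⥤ B) : Prop where
  complete : HasLimitsOfSize.{u, u} E
  cocomplete : HasColimitsOfSize.{u, u} E
  continuous : PreservesLimitsOfSize.{u, u} P
  cocontinuous : PreservesColimitsOfSize.{u, u} P

end FOLE

/-! Every projection here is, up to composition, `Comma.snd (𝟭 _) R` with `R` an arbitrary functor
from a bicomplete base to sets. Colimits are componentwise, because the identity preserves them.
Limits need no continuity of `R`: the keys are the pullback of `lim Kⱼ ⟶ lim R Bⱼ ⟵ R (lim Bⱼ)`,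
which lies over `lim Bⱼ` (`pullbackConeIsLimit`). What remains is that the bases are bicomplete. For
`Cls`, colimits take the colimit of the sorts and the limit of the values, and limits follow from
the self-duality exchanging the two. -/

namespace CategoryTheory.Comma

variable {J : Type*} [Category* J] {C : Type*} [Category* C] {B : Type*} [Category* B]

section

variable {R : B ⥤ C} (F : J ⥤ Comma (𝟭 C) R)
  [HasLimit (F ⋙ fst (𝟭 C) R)] [HasLimit ((F ⋙ snd (𝟭 C) R) ⋙ R)] [HasPullbacks C]

/-- A cone over `F ⋙ snd` underlies a cone over `F` whose left component is the pullback of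
the limit of the left components along the comparison map. Nothing is asked of `R`. -/
noncomputable def pullbackCone (c : Cone (F ⋙ snd (𝟭 C) R)) : Cone F where
  pt :=
    { left := pullback
        (limit.lift ((F ⋙ snd (𝟭 C) R) ⋙ R)
          (limitAuxiliaryCone F (limit.cone (F ⋙ fst (𝟭 C) R))))
        (limit.lift ((F ⋙ snd (𝟭 C) R) ⋙ R) (R.mapCone c))
      right := c.pt
      hom := pullback.snd _ _ }
  π :=
    { app := fun j =>
        { left := pullback.fst _ _ ≫ limit.π (F ⋙ fst (𝟭 C) R) j
          right := c.π.app j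
          w := by
            have h := congrArg (· ≫ limit.π ((F ⋙ snd (𝟭 C) R) ⋙ R) j)
              (pullback.condition
                (f := limit.lift ((F ⋙ snd (𝟭 C) R) ⋙ R)
                  (limitAuxiliaryCone F (limit.cone (F ⋙ fst (𝟭 C) R))))
                (g := limit.lift ((F ⋙ snd (𝟭 C) R) ⋙ R) (R.mapCone c)))
            simp only [Category.assoc, limit.lift_π] at h
            exact (Category.assoc _ _ _).trans h }
      naturality := fun j k f => by
        ext
        · have h := limit.w (F ⋙ fst (𝟭 C) R) f
          exact (Category.id_comp _).trans
            ((congrArg (pullback.fst _ _ ≫ ·) h).symm.trans (Category.assoc _ _ _).symm)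
        · simp [← c.w f] }

variable {F} in
/-- The cone `pullbackCone` over a limit cone is a limit cone. -/
noncomputable def pullbackConeIsLimit {c : Cone (F ⋙ snd (𝟭 C) R)} (hc : IsLimit c) :
    IsLimit (pullbackCone F c) where
  lift s :=
    { left := pullback.lift
        (limit.lift (F ⋙ fst (𝟭 C) R) ((fst (𝟭 C) R).mapCone s))
        (s.pt.hom ≫ R.map (hc.lift ((snd (𝟭 C) R).mapCone s)))
        (by
          -- At each `j` the two legs agree by the commuting square of `s.π.app j`.
          refine limit.hom_ext fun j => ?_
          have h₁ : limit.lift (F ⋙ fst (𝟭 C) R) ((fst (𝟭 C) R).mapCone s) ≫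
              limit.π (F ⋙ fst (𝟭 C) R) j ≫ (F.obj j).hom = (s.π.app j).left ≫ (F.obj j).hom :=
            limit.lift_π_assoc _ _ _
          have h₂ : R.map (hc.lift ((snd (𝟭 C) R).mapCone s)) ≫ R.map (c.π.app j) =
              R.map (s.π.app j).right :=
            (R.map_comp _ _).symm.trans (congrArg R.map (hc.fac ((snd (𝟭 C) R).mapCone s) j))
          refine (Category.assoc _ _ _).trans ?_
          refine Eq.trans ?_ (Category.assoc _ _ _).symm
          rw [limit.lift_π, limit.lift_π]
          refine Eq.trans ?_ (Category.assoc _ _ _).symm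
          exact h₁.trans ((s.π.app j).w.trans (congrArg (s.pt.hom ≫ ·) h₂).symm))
      right := hc.lift ((snd (𝟭 C) R).mapCone s)
      w := pullback.lift_snd _ _ _ }
  fac s j := by
    ext
    · exact (pullback.lift_fst_assoc _ _ _ _).trans (limit.lift_π _ j)
    · exact hc.fac ((snd (𝟭 C) R).mapCone s) j
  uniq s m hm := by
    have hr : m.right = hc.lift ((snd (𝟭 C) R).mapCone s) :=
      hc.uniq ((snd (𝟭 C) R).mapCone s) _ fun j =>
        congrArg CommaMorphism.right (hm j)
    have hl : (m.left ≫ pullback.fst _ _ : s.pt.left ⟶ limit (F ⋙ fst (𝟭 C) R)) =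
        limit.lift (F ⋙ fst (𝟭 C) R) ((fst (𝟭 C) R).mapCone s) :=
      limit.hom_ext fun j => ((Category.assoc _ _ _).trans
        (congrArg CommaMorphism.left (hm j))).trans
          (limit.lift_π ((fst (𝟭 C) R).mapCone s) j).symm
    ext
    · refine pullback.hom_ext (hl.trans (pullback.lift_fst _ _ _).symm)
        (Eq.trans ?_ (pullback.lift_snd _ _ _).symm)
      exact m.w.trans (congrArg (fun f => s.pt.hom ≫ R.map f) hr)
    · exact hr

end

variable (R : B ⥤ C)

lemma hasLimitsOfShape_of_hasPullbacks [HasLimitsOfShape J C] [HasLimitsOfShape J B]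
    [HasPullbacks C] : HasLimitsOfShape J (Comma (𝟭 C) R) where
  has_limit _ := ⟨⟨_, pullbackConeIsLimit (limit.isLimit _)⟩⟩

/-- The image of `pullbackCone F c` under `snd` is `c` itself, so one limit cone is sent to a limit
cone. -/
lemma preservesLimitsOfShape_snd_of_hasPullbacks [HasLimitsOfShape J C] [HasLimitsOfShape J B]
    [HasPullbacks C] : PreservesLimitsOfShape J (snd (𝟭 C) R) where
  preservesLimit {F} :=
    preservesLimit_of_preserves_limit_cone
      (pullbackConeIsLimit (limit.isLimit (F ⋙ snd (𝟭 C) R))) (limit.isLimit _)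

end CategoryTheory.Comma

namespace FOLE

lemma isBicompleteProjection_snd {B : Type (u + 1)} [Category.{u} B]
    [HasLimitsOfSize.{u, u} B] [HasColimitsOfSize.{u, u} B] (R : B ⥤ Type u) :
    IsBicompleteProjection (Comma.snd (𝟭 (Type u)) R) where
  complete := ⟨fun _ _ => Comma.hasLimitsOfShape_of_hasPullbacks R⟩
  cocomplete := inferInstance
  continuous := ⟨Comma.preservesLimitsOfShape_snd_of_hasPullbacks R⟩
  cocontinuous := ⟨inferInstance⟩

namespace Cls

/-- The contravariant data value functor. -/
def values : Cls.{u}ᵒᵖ ⥤ Type u where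
  obj A := A.unop.Values
  map p := Hom.valueMap p.unop

variable {J : Type u} [Category.{u} J] (F : J ⥤ Cls.{u})

/-- The sorts classified by a compatible family of data values, as a cocone. -/
noncomputable def modelsCocone (y : (limit (F.op ⋙ values) : Type u)) : Cocone (F ⋙ sort) where
  -- Subsets of the sorts are maps to `Prop`; the infomorphism condition is exactly their
  -- compatibility along the diagram.
  pt := ULift.{u} Prop
  ι :=
    { app := fun j => TypeCat.ofHom fun x =>
        ⟨(F.obj j).models (limit.π (F.op ⋙ values) (op j) y) x⟩
      naturality := fun j k f => by
        ext x
        have h : (F.map f).valueMap (limit.π (F.op ⋙ values) (op k) y) =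
            limit.π (F.op ⋙ values) (op j) y :=
          limit.w_apply (F.op ⋙ values) f.op y
        have h' := (F.map f).models_iff x (limit.π (F.op ⋙ values) (op k) y)
        rw [h] at h'
        exact congrArg ULift.up (propext h'.symm) }

/-- The colimit classification: the colimit of the sorts and the limit of the data values. -/
noncomputable def colimitCls : Cls.{u} where
  Sorts := colimit (F ⋙ sort)
  Values := limit (F.op ⋙ values)
  models y x := (colimit.desc (F ⋙ sort) (modelsCocone F y) x).down

/-- This makes the coprojections infomorphisms, and it determines the relation, since the
coprojections are jointly surjective on sorts. -/
lemma colimitCls_models_ι (y : (limit (F.op ⋙ values) : Type u)) (j : J) (x : (F.obj j).Sorts) :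
    (colimitCls F).models y (colimit.ι (F ⋙ sort) j x) ↔
      (F.obj j).models (limit.π (F.op ⋙ values) (op j) y) x :=
  iff_of_eq (congrArg ULift.down
    (ConcreteCategory.congr_hom (colimit.ι_desc (modelsCocone F y) j) x))

/-- The colimit cocone of classifications. -/
noncomputable def colimitCocone : Cocone F where
  pt := colimitCls F
  ι :=
    { app := fun j =>
        { sortMap := colimit.ι (F ⋙ sort) j
          valueMap := limit.π (F.op ⋙ values) (op j)
          models_iff := fun x y => (colimitCls_models_ι F y j x).symm }
      naturality := fun _ _ f => Hom.ext
        ((colimit.w (F ⋙ sort) f).trans (Category.comp_id _).symm)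
        ((limit.w (F.op ⋙ values) f.op).trans (Category.id_comp _).symm) }

/-- The cone of data values of a cocone of classifications. -/
def valuesCone {F : J ⥤ Cls.{u}} (s : Cocone F) : Cone (F.op ⋙ values) :=
  values.mapCone s.op

/-- `colimitCocone` is a colimit cocone. -/
noncomputable def colimitCoconeIsColimit : IsColimit (colimitCocone F) where
  desc s :=
    { sortMap := colimit.desc (F ⋙ sort) (sort.mapCocone s)
      valueMap := limit.lift (F.op ⋙ values) (valuesCone s)
      models_iff := fun x y => by
        -- Each sort of the colimit comes from some stage `j`, where the condition is that of
        -- `s.ι.app j`.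
        obtain ⟨j, x, rfl⟩ := Types.jointly_surjective_of_isColimit (colimit.isColimit _) x
        have h₁ : colimit.desc (F ⋙ sort) (sort.mapCocone s) (colimit.ι (F ⋙ sort) j x) =
            (s.ι.app j).sortMap x :=
          ConcreteCategory.congr_hom (colimit.ι_desc (sort.mapCocone s) j) x
        have h₂ : limit.π (F.op ⋙ values) (op j) (limit.lift _ (valuesCone s) y) =
            (s.ι.app j).valueMap y :=
          ConcreteCategory.congr_hom (limit.lift_π (valuesCone s) (op j)) y
        refine (colimitCls_models_ι F _ j x).trans ?_
        refine (iff_of_eq (congrArg ((F.obj j).models · x) h₂)).trans ?_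
        refine ((s.ι.app j).models_iff x y).trans (iff_of_eq ?_)
        exact congrArg (s.pt.models y) h₁.symm }
  fac s j := Hom.ext (colimit.ι_desc (sort.mapCocone s) j) (limit.lift_π (valuesCone s) (op j))
  uniq s m hm := Hom.ext
    (colimit.hom_ext fun j =>
      (congrArg Hom.sortMap (hm j)).trans (colimit.ι_desc (sort.mapCocone s) j).symm)
    (limit.hom_ext fun j =>
      (congrArg Hom.valueMap (hm j.unop)).trans (limit.lift_π (valuesCone s) j).symm)

instance : HasColimitsOfSize.{u, u} Cls.{u} where
  has_colimits_of_shape _ _ := { has_colimit F := ⟨⟨_, colimitCoconeIsColimit F⟩⟩ }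

/-- The involution of classifications, exchanging sorts and data values. -/
def swap : Cls.{u} ⥤ Cls.{u}ᵒᵖ where
  obj A := op ⟨A.Values, A.Sorts, fun x y => A.models y x⟩
  map p := Quiver.Hom.op ⟨p.valueMap, p.sortMap, fun y x => (p.models_iff x y).symm⟩

/-- The category of classifications is self-dual. -/
def swapEquivalence : Cls.{u} ≌ Cls.{u}ᵒᵖ where
  functor := swap
  inverse := swap.leftOp
  unitIso := Iso.refl _
  counitIso := Iso.refl _

instance : HasLimitsOfSize.{u, u} Cls.{u} :=
  Adjunction.has_limits_of_equivalence swapEquivalence.functor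

end Cls

lemma isBicompleteProjection_sort : IsBicompleteProjection Sign.sort.{u} :=
  isBicompleteProjection_snd _

/-- Used twice: it makes `Dom` a bicomplete base for `Tbl`, and it supplies the second factor of
`Tbl.data`. -/
lemma isBicompleteProjection_domData : IsBicompleteProjection Dom.data.{u} :=
  isBicompleteProjection_snd _

lemma isBicompleteProjection_dom : IsBicompleteProjection Tbl.dom.{u} :=
  haveI := isBicompleteProjection_domData.{u}.complete
  haveI := isBicompleteProjection_domData.{u}.cocomplete
  isBicompleteProjection_snd _

lemma isBicompleteProjection_sign (A : Cls.{u}) : IsBicompleteProjection (TblOver.sign A) :=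
  isBicompleteProjection_snd _

lemma isBicompleteProjection_data : IsBicompleteProjection Tbl.data.{u} :=
  haveI := isBicompleteProjection_domData.{u}.continuous
  haveI := isBicompleteProjection_domData.{u}.cocontinuous
  haveI := isBicompleteProjection_dom.{u}.continuous
  haveI := isBicompleteProjection_dom.{u}.cocontinuous
  -- Passing to opposites swaps the roles: cocontinuity of `Dom.data` gives continuity of its
  -- opposite, and conversely.
  haveI := preservesLimitsOfSize_op.{u, u} Dom.data.{u}
  haveI := preservesColimitsOfSize_op.{u, u} Dom.data.{u}
  { complete := isBicompleteProjection_dom.complete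
    cocomplete := isBicompleteProjection_dom.cocomplete
    continuous := comp_preservesLimits _ _
    cocontinuous := comp_preservesColimits _ _ }

end FOLE

theorem mainTheorem7 :
    FOLE.IsBicompleteProjection FOLE.Sign.sort.{u} ∧
    FOLE.IsBicompleteProjection FOLE.Tbl.dom.{u} ∧
    (∀ A : FOLE.Cls.{u}, FOLE.IsBicompleteProjection (FOLE.TblOver.sign A)) ∧
    FOLE.IsBicompleteProjection FOLE.Tbl.data.{u} :=
  ⟨FOLE.isBicompleteProjection_sort, FOLE.isBicompleteProjection_dom,
    FOLE.isBicompleteProjection_sign, FOLE.isBicompleteProjection_data⟩
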